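/- Let $\mathcal G$ be a graph with finite vertex set $V$ (loops and parallel edges are allowed). Let $\mathcal G'$ be the loopless graph on $V$ in which two distinct vertices are adjacent if and only if they are adjacent in $\mathcal G$, and in which each pair of adjacent vertices is joined by exactly two edges. Let $\overline{\mathcal G}$ be obtained from $\mathcal G'$ by adding one new vertex $x$ together with a pair of parallel edges from $x$ to each $v\in V$. A path-decomposition of $\mathcal G$ is a sequence $(V_1,\dots,V_t)$, $t\ge 1$, of subsets of $V$ with $\bigcup_i V_i=V$, such that any two adjacent vertices lie together in some $V_i$, and $V_i\cap V_k\subseteq V_j$ whenever $i<j<k$; its width is $\max_i|V_i|-1$, and $\mathrm{pw}(\mathcal G)$ is the minimum width of a path-decomposition of $\mathcal G$. For a matroid $M$ with finite ground set $E$ and rank function $r$, let $\lambda_M(X)=r(X)+r(E\setminus X)-r(E)$ for $X\subseteq E$, and let $$\mathrm{pw}(M)=\min_{(e_1,\dots,e_n)}\ \max_{0\le i\le n}\lambda_M(\{e_1,\dots,e_i\}),$$ the minimum being over all orderings $(e_1,\dots,e_n)$ of $E$. Then the cycle matroid $M(\overline{\mathcal G})$, whose ground set is the edge set of $\overline{\mathcal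 G}$ and whose independent sets are the edge sets containing no cycle, satisfies $$\mathrm{pw}(M(\overline{\mathcal G}))=\mathrm{pw}(\mathcal G)+1 .$$ -/

import Mathlib

open scoped Graph

noncomputable section

namespace Graph

variable {α β : Type*}

/-! ### Pathwidth of a graph -/

/-- A path-decomposition of `G` with `t + 1 ≥ 1` bags: the bags cover exactly the vertex set, the
two ends of every edge lie in a common bag, and `𝒱 i ∩ 𝒱 k ⊆ 𝒱 j` whenever `i < j < k`. -/
structure IsPathDecomposition (G : Graph α β) {t : ℕ} (𝒱 : Fin (t + 1) → Finset α) : Prop where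
  iUnion_eq : (⋃ i, (𝒱 i : Set α)) = V(G)
  exists_mem_of_adj : ∀ u v, G.Adj u v → ∃ i, u ∈ 𝒱 i ∧ v ∈ 𝒱 i
  mem_of_lt_of_lt : ∀ i j k, i < j → j < k → ∀ v, v ∈ 𝒱 i → v ∈ 𝒱 k → v ∈ 𝒱 j

/-- The width of a sequence of bags: the largest size of a bag, minus one (an integer). -/
def pathDecompositionWidth {t : ℕ} (𝒱 : Fin (t + 1) → Finset α) : ℤ :=
  Finset.univ.sup' Finset.univ_nonempty (fun i => ((𝒱 i).card : ℤ)) - 1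

/-- The pathwidth of a graph with finitely many vertices: the minimum of the widths of its
path-decompositions (a nonempty set of integers that is bounded below by `-1`). -/
def pathwidth (G : Graph α β) : ℤ :=
  sInf {w | ∃ (t : ℕ) (𝒱 : Fin (t + 1) → Finset α),
    G.IsPathDecomposition 𝒱 ∧ w = pathDecompositionWidth 𝒱}

/-! ### The cycle matroid of a graph -/

/-- `C` is the edge set of a cycle of `G`, of length `n + 1 ≥ 1`: the vertices `v 0, …, v n` are
distinct, the edges `e 0, …, e n` are distinct, and `e i` joins `v i` to `v (i + 1)`, where `i + 1`
is taken modulo `n + 1`. Loops are the cycles of length one, and pairs of parallel edges are the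
cycles of length two. -/
def IsCycleSet (G : Graph α β) (C : Set β) : Prop :=
  ∃ (n : ℕ) (v : Fin (n + 1) → α) (e : Fin (n + 1) → β),
    Function.Injective v ∧ Function.Injective e ∧
      (∀ i, G.IsLink (e i) (v i) (v (i + 1))) ∧ C = Set.range e

/-- A set of edges is acyclic if it contains the edge set of no cycle. -/
def IsAcyclicSet (G : Graph α β) (I : Set β) : Prop :=
  I ⊆ E(G) ∧ ∀ C ⊆ I, ¬ G.IsCycleSet C

/-- The mod-2 incidence vector of an edge, used only to verify the matroid axioms. -/
def incVec (G : Graph α β) (e : β) : α →₀ ZMod 2 :=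
  open Classical in
  if h : ∃ p : α × α, G.IsLink e p.1 p.2 then
    Finsupp.single h.choose.1 1 + Finsupp.single h.choose.2 1
  else 0

lemma incVec_eq {G : Graph α β} {e : β} {u v : α} (h : G.IsLink e u v) :
    G.incVec e = Finsupp.single u 1 + Finsupp.single v 1 := by
  have h' : ∃ p : α × α, G.IsLink e p.1 p.2 := ⟨(u, v), h⟩
  rw [incVec, dif_pos h']
  rcases h'.choose_spec.eq_and_eq_or_eq_and_eq h with ⟨h1, h2⟩ | ⟨h1, h2⟩
  · rw [h1, h2]
  · rw [h1, h2, add_comm]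

/-- If the ends of `f` are joined in the graph of the edges in `J`, and `f ∉ J`, then `J` and `f`
together contain a cycle. -/
lemma exists_isCycleSet_of_reachable {G : Graph α β} {J : Set β} {f : β} {u v : α}
    (hf : G.IsLink f u v) (hfJ : f ∉ J)
    (huv : (SimpleGraph.fromRel (fun x y => ∃ e ∈ J, G.IsLink e x y)).Reachable v u) :
    ∃ C ⊆ insert f J, G.IsCycleSet C := by
  classical
  obtain ⟨p, hp⟩ := huv.exists_isPath
  have key : ∀ i : ℕ, ∃ e, i < p.length → e ∈ J ∧ G.IsLink e (p.getVert i) (p.getVert (i + 1)) := by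
    intro i
    by_cases hi : i < p.length
    · have := p.adj_getVert_succ hi
      rw [SimpleGraph.fromRel_adj] at this
      rcases this.2 with ⟨e, he, hl⟩ | ⟨e, he, hl⟩
      · exact ⟨e, fun _ => ⟨he, hl⟩⟩
      · exact ⟨e, fun _ => ⟨he, hl.symm⟩⟩
    · exact ⟨f, fun h => absurd h hi⟩
  choose g hg using key
  have hinj : ∀ i j : ℕ, i ≤ p.length → j ≤ p.length → p.getVert i = p.getVert j → i = j :=
    fun i j hi hj h => hp.getVert_injOn hi hj h
  let e : Fin (p.length + 1) → β := fun i => if i.1 < p.length then g i.1 else f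
  refine ⟨Set.range e, ?_, p.length, fun i => p.getVert i.1, e, ?_, ?_, ?_, rfl⟩
  · rintro _ ⟨i, rfl⟩
    by_cases hi : i.1 < p.length
    · simp only [e, if_pos hi]
      exact Or.inr (hg _ hi).1
    · simp only [e, if_neg hi]
      exact Or.inl rfl
  · intro i j h
    exact Fin.ext (hinj _ _ (by omega) (by omega) h)
  · intro i j h
    by_cases hi : i.1 < p.length <;> by_cases hj : j.1 < p.length
    · simp only [e, if_pos hi, if_pos hj] at h
      have h1 := (hg _ hi).2
      rw [h] at h1
      rcases h1.eq_and_eq_or_eq_and_eq (hg _ hj).2 with ⟨h2, -⟩ | ⟨h2, h3⟩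
      · exact Fin.ext (hinj _ _ (by omega) (by omega) h2)
      · have := hinj _ _ (by omega) (by omega) h2
        have := hinj _ _ (by omega) (by omega) h3
        omega
    · simp only [e, if_pos hi, if_neg hj] at h
      exact absurd (h ▸ (hg _ hi).1) hfJ
    · simp only [e, if_neg hi, if_pos hj] at h
      exact absurd (h ▸ (hg _ hj).1) hfJ
    · exact Fin.ext (by omega)
  · intro i
    by_cases hi : i.1 < p.length
    · have : (i + 1).1 = i.1 + 1 := by
        rw [Fin.val_add_one, if_neg]
        intro h
        rw [h] at hi
        simp at hi
      simp only [e, if_pos hi, this]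
      exact (hg _ hi).2
    · have hl : i = Fin.last p.length := Fin.ext (by simp; omega)
      subst hl
      simpa [e] using hf

lemma linearIndepOn_incVec {G : Graph α β} {I : Set β} (hI : G.IsAcyclicSet I) :
    LinearIndepOn (ZMod 2) G.incVec I := by
  classical
  rw [linearIndepOn_iff_notMem_span]
  intro f hf hspan
  obtain ⟨u, v, huv⟩ := exists_isLink_of_mem_edgeSet (hI.1 hf)
  let H : SimpleGraph α := SimpleGraph.fromRel (fun x y => ∃ e ∈ I \ {f}, G.IsLink e x y)
  let φ : (α →₀ ZMod 2) →ₗ[ZMod 2] ZMod 2 :=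
    Finsupp.linearCombination (ZMod 2) (fun x => if H.Reachable x u then (1 : ZMod 2) else 0)
  have hφ : ∀ {e x y}, G.IsLink e x y → φ (G.incVec e) =
      (if H.Reachable x u then (1 : ZMod 2) else 0) + if H.Reachable y u then 1 else 0 := by
    intro e x y h
    rw [incVec_eq h]
    simp [φ]
  have h0 : Submodule.span (ZMod 2) (G.incVec '' (I \ {f})) ≤ LinearMap.ker φ := by
    rw [Submodule.span_le]
    rintro _ ⟨e, he, rfl⟩
    obtain ⟨x, y, hxy⟩ := exists_isLink_of_mem_edgeSet (hI.1 he.1)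
    rw [SetLike.mem_coe, LinearMap.mem_ker, hφ hxy]
    have hr : H.Reachable x y := by
      by_cases hne : x = y
      · rw [hne]
      · exact SimpleGraph.Adj.reachable
          ((SimpleGraph.fromRel_adj _ _ _).2 ⟨hne, Or.inl ⟨e, he, hxy⟩⟩)
    have : H.Reachable x u ↔ H.Reachable y u := ⟨fun h => hr.symm.trans h, fun h => hr.trans h⟩
    simp only [this]
    exact CharTwo.add_self_eq_zero _
  have h1 := h0 hspan
  rw [LinearMap.mem_ker, hφ huv, if_pos (SimpleGraph.Reachable.refl u)] at h1
  by_cases hv : H.Reachable v u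
  · obtain ⟨C, hC, hcyc⟩ := exists_isCycleSet_of_reachable huv (by simp) hv
    refine hI.2 C (hC.trans ?_) hcyc
    exact Set.insert_subset hf Set.sdiff_subset
  · simp [hv] at h1

lemma isAcyclicSet_of_linearIndepOn {G : Graph α β} {I : Set β} (hE : I ⊆ E(G))
    (hI : LinearIndepOn (ZMod 2) G.incVec I) : G.IsAcyclicSet I := by
  refine ⟨hE, ?_⟩
  rintro C hC ⟨n, v, e, -, he, hl, rfl⟩
  have hind : LinearIndependent (ZMod 2) (fun i => G.incVec (e i)) :=
    LinearIndependent.comp hI (fun i => (⟨e i, hC ⟨i, rfl⟩⟩ : I))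
      (fun i j h => he (congrArg Subtype.val h))
  rw [Fintype.linearIndependent_iff] at hind
  refine one_ne_zero (hind (fun _ => 1) ?_ 0)
  have hs : ∑ i, (Finsupp.single (v (i + 1)) 1 : α →₀ ZMod 2) = ∑ i, Finsupp.single (v i) 1 :=
    Equiv.sum_comp (Equiv.addRight (1 : Fin (n + 1))) (fun i => (Finsupp.single (v i) 1 : α →₀ ZMod 2))
  simp_rw [one_smul, incVec_eq (hl _), Finset.sum_add_distrib, hs]
  ext x
  exact CharTwo.add_self_eq_zero _

lemma isAcyclicSet_iff {G : Graph α β} {I : Set β} :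
    G.IsAcyclicSet I ↔ I ⊆ E(G) ∧ LinearIndepOn (ZMod 2) G.incVec I :=
  ⟨fun h => ⟨h.1, linearIndepOn_incVec h⟩, fun h => isAcyclicSet_of_linearIndepOn h.1 h.2⟩

lemma IsAcyclicSet.exists_insert {G : Graph α β} {I J : Set β} (hI : G.IsAcyclicSet I)
    (hIfin : I.Finite) (hJ : G.IsAcyclicSet J) (hJfin : J.Finite) (hlt : I.ncard < J.ncard) :
    ∃ e ∈ J, e ∉ I ∧ G.IsAcyclicSet (insert e I) := by
  classical
  by_contra! hcon
  have hIl := linearIndepOn_incVec hI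
  have hJl := linearIndepOn_incVec hJ
  have hsub : G.incVec '' J ⊆ Submodule.span (ZMod 2) (G.incVec '' I) := by
    rintro _ ⟨e, he, rfl⟩
    by_cases heI : e ∈ I
    · exact Submodule.subset_span ⟨e, heI, rfl⟩
    · by_contra hne
      exact hcon e he heI (isAcyclicSet_of_linearIndepOn
        (Set.insert_subset (hJ.1 he) hI.1) (hIl.insert hne))
  have := hIfin.fintype
  have := hJfin.fintype
  have h1 := finrank_span_eq_card hIl
  have h2 := finrank_span_eq_card hJl
  have hr : ∀ K : Set β, Set.range (fun x : K => G.incVec x) = G.incVec '' K :=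
    fun K => Set.image_eq_range _ _ |>.symm
  rw [hr] at h1 h2
  have : FiniteDimensional (ZMod 2) (Submodule.span (ZMod 2) (G.incVec '' I)) :=
    FiniteDimensional.span_of_finite _ (hIfin.image _)
  have h3 := Submodule.finrank_mono (Submodule.span_le.2 hsub)
  rw [h1, h2, ← Nat.card_eq_fintype_card, ← Nat.card_eq_fintype_card, Nat.card_coe_set_eq,
    Nat.card_coe_set_eq] at h3
  omega

/-- The cycle matroid `M(G)`: its ground set is the edge set of `G`, and its independent sets are
the sets of edges that contain no cycle. -/
def cycleMatroid (G : Graph α β) : Matroid β :=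
  (IndepMatroid.ofFinitaryCardAugment E(G) G.IsAcyclicSet
    (isAcyclicSet_iff.2 ⟨Set.empty_subset _, linearIndepOn_empty _ _⟩)
    (fun _ _ hJ hIJ => ⟨hIJ.trans hJ.1, fun C hC => hJ.2 C (hC.trans hIJ)⟩)
    (fun _ _ hI hIfin hJ hJfin hlt => hI.exists_insert hIfin hJ hJfin hlt)
    (by
      intro I h
      refine ⟨fun e he => (h {e} (by simpa using he) (Set.finite_singleton e)).1 rfl, ?_⟩
      rintro C hC ⟨n, v, e, hv, he, hl, rfl⟩
      exact (h (Set.range e) hC (Set.finite_range e)).2 _ subset_rfl ⟨n, v, e, hv, he, hl, rfl⟩)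
    (fun _ hI => hI.1)).matroid

@[simp] lemma cycleMatroid_ground (G : Graph α β) : G.cycleMatroid.E = E(G) := rfl

@[simp] lemma cycleMatroid_indep (G : Graph α β) {I : Set β} :
    G.cycleMatroid.Indep I ↔ G.IsAcyclicSet I := by
  exact Iff.rfl

/-! ### The construction of `Ḡ` -/

/-- The graph `G'` on the vertex set of `G`: it has no loops, two distinct vertices are adjacent in
`G'` iff they are adjacent in `G`, and then exactly two edges of `G'` join `u` and `v`, namely
`(s(u, v), false)` and `(s(u, v), true)`. -/
def doubled (G : Graph α β) : Graph α (Sym2 α × Bool) where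
  vertexSet := V(G)
  IsLink e u v := e.1 = s(u, v) ∧ u ≠ v ∧ G.Adj u v
  isLink_symm e _ := ⟨fun u v h => ⟨h.1.trans Sym2.eq_swap, h.2.1.symm, h.2.2.symm⟩⟩
  eq_or_eq_of_isLink_of_isLink := by
    intro e x y v w h h'
    have := h.1.symm.trans h'.1
    rw [Sym2.eq_iff] at this
    tauto
  left_mem_of_isLink _ _ _ h := h.2.2.left_mem

/-- The graph obtained from `H` by adding a new vertex `x`, here `none`, together with two parallel
edges `Sum.inr (v, false)` and `Sum.inr (v, true)` from `x` to each vertex `v` of `H`. The old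
vertices and edges are `some v` and `Sum.inl e`. -/
def addDoubleApex (H : Graph α β) : Graph (Option α) (β ⊕ α × Bool) where
  vertexSet := insert none (some '' V(H))
  IsLink e a b :=
    (∃ f u v, e = Sum.inl f ∧ a = some u ∧ b = some v ∧ H.IsLink f u v) ∨
    (∃ v c, e = Sum.inr (v, c) ∧ v ∈ V(H) ∧ (a = none ∧ b = some v ∨ a = some v ∧ b = none))
  isLink_symm e _ := by
    refine ⟨?_⟩
    rintro a b (⟨f, u, v, rfl, rfl, rfl, h⟩ | ⟨v, c, rfl, hv, h⟩)
    · exact Or.inl ⟨f, v, u, rfl, rfl, rfl, h.symm⟩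
    · exact Or.inr ⟨v, c, rfl, hv, by tauto⟩
  eq_or_eq_of_isLink_of_isLink := by
    rintro e a b a' b' (⟨f, u, v, rfl, rfl, rfl, h⟩ | ⟨v, c, rfl, hv, h⟩)
      (⟨f', u', v', hf, rfl, rfl, h'⟩ | ⟨v', c', hf, hv', h'⟩)
    · obtain rfl := Sum.inl_injective hf
      simpa using h.left_eq_or_eq h'
    · simp at hf
    · simp at hf
    · obtain ⟨rfl, rfl⟩ := Prod.mk.inj (Sum.inr_injective hf)
      rcases h with ⟨rfl, rfl⟩ | ⟨rfl, rfl⟩ <;> rcases h' with ⟨rfl, rfl⟩ | ⟨rfl, rfl⟩ <;> simp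
  left_mem_of_isLink := by
    rintro e a b (⟨f, u, v, rfl, rfl, rfl, h⟩ | ⟨v, c, rfl, hv, ⟨rfl, rfl⟩ | ⟨rfl, rfl⟩⟩)
    · exact Or.inr ⟨u, h.left_mem, rfl⟩
    · exact Or.inl rfl
    · exact Or.inr ⟨v, hv, rfl⟩

/-- The graph `Ḡ` obtained from `G'` by adding the vertex `x` and a pair of parallel edges from `x`
to each vertex. -/
def bar (G : Graph α β) : Graph (Option α) ((Sym2 α × Bool) ⊕ (α × Bool)) :=
  G.doubled.addDoubleApex

end Graph

/-! ### Pathwidth of a matroid -/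

namespace Matroid

variable {γ : Type*}

/-- The connectivity function `λ_M(X) = r(X) + r(E - X) - r(E)` of a matroid on a finite set. -/
def connectivity (M : Matroid γ) (X : Set γ) : ℤ :=
  ((M.eRk X).toNat : ℤ) + ((M.eRk (M.E \ X)).toNat : ℤ) - ((M.eRk M.E).toNat : ℤ)

/-- `l` is an ordering `(e₁, …, eₙ)` of the elements of `M`. -/
def IsOrdering (M : Matroid γ) (l : List γ) : Prop :=
  l.Nodup ∧ ∀ e, e ∈ l ↔ e ∈ M.E

/-- The width of an ordering: the maximum of `λ_M({e₁, …, eᵢ})` over `0 ≤ i ≤ n`. Including `i = 0`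
changes nothing when `n ≥ 1`, since `λ_M(∅) = λ_M(E) = 0`; for `n = 0` it makes the width `0`. -/
def orderingWidth (M : Matroid γ) (l : List γ) : ℤ :=
  (Finset.range (l.length + 1)).sup' Finset.nonempty_range_add_one
    (fun i => M.connectivity {e | e ∈ l.take i})

/-- The pathwidth of a matroid on a finite set: the minimum of the widths of its orderings
(a nonempty set of nonnegative integers). -/
def pathwidth (M : Matroid γ) : ℤ :=
  sInf {w | ∃ l : List γ, M.IsOrdering l ∧ w = M.orderingWidth l}

end Matroid

end

open scoped Graph

noncomputable section

namespace Graph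

variable {α β : Type*}

/-! Over GF(2), rank in the cycle matroid is the dimension of a span of incidence vectors. In
`G.bar` the spoke vectors of the vertices are independent, and an edge `uv` of `G'` has vector
`spoke u + spoke v`, so the total rank is |V|.

From an ordering to bags: let `A i` and `B i` be the vertices joined to the apex by the first `i`
edges and by the remaining ones. Independence of spokes bounds the two ranks below by |A i| and |B
i|. Since `A i ∪ B i = V`, this gives λ ≥ |A i| + |B i| - |V| = |A i ∩ B i|. The bags are `A i ∩ B
i`. As `A` grows and `B` shrinks, each vertex occupies an interval. Doubling the edges ensures
covering: when two adjacent vertices first both lie in `A i`, only one edge has just been added, so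
a twin of every edge needed for `B i` is still unused (`mem_apexReach_compl_of_adj`).

From bags to an ordering: sort the edges by a bag containing their ends other than the apex. A cut
of this order splits V into the union of the bags up to some `j` and the union of those from `j` on.
These unions bound the two ranks above, and they meet inside the bag `j`, so λ is at most the size
of that bag. -/

/-- The rank function of the cycle matroid is the dimension of the span of the incidence vectors. -/
lemma eRk_cycleMatroid (G : Graph α β) {X : Set β} (hX : X ⊆ E(G)) (hfin : X.Finite) :
    (G.cycleMatroid.eRk X).toNat =
      Module.finrank (ZMod 2) (Submodule.span (ZMod 2) (G.incVec '' X)) := by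
  obtain ⟨I, hI⟩ := G.cycleMatroid.exists_isBasis X hX
  have hIl := (isAcyclicSet_iff.1 hI.indep).2
  have hspan : Submodule.span (ZMod 2) (G.incVec '' X) =
      Submodule.span (ZMod 2) (G.incVec '' I) := by
    refine le_antisymm (Submodule.span_le.2 ?_)
      (Submodule.span_mono (Set.image_mono hI.subset))
    rintro _ ⟨e, he, rfl⟩
    by_contra hne
    have heI : e ∉ I := fun h => hne (Submodule.subset_span ⟨e, h, rfl⟩)
    have hins : G.cycleMatroid.Indep (insert e I) :=
      isAcyclicSet_iff.2 ⟨Set.insert_subset (hX he) (hI.subset.trans hX), hIl.insert hne⟩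
    exact heI (hI.mem_of_insert_indep he hins)
  have := (hfin.subset hI.subset).fintype
  have h1 := finrank_span_eq_card hIl
  rw [← Set.image_eq_range] at h1
  rw [hspan, h1, ← hI.encard_eq_eRk, ← Nat.card_eq_fintype_card, Nat.card_coe_set_eq]
  rfl

/-! ### Spoke vectors and the edges of `G.bar` -/

/-- The incidence vector of an edge from the apex to `v`. -/
def spoke (v : α) : Option α →₀ ZMod 2 :=
  Finsupp.single none 1 + Finsupp.single (some v) 1

/-- Forgetting the apex coordinate sends the spokes to the standard basis. -/
lemma linearIndependent_spoke : LinearIndependent (ZMod 2) (spoke : α → Option α →₀ ZMod 2) := by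
  refine LinearIndependent.of_comp
    (Finsupp.lcomapDomain (R := ZMod 2) (some : α → Option α) (Option.some_injective α)) ?_
  have : (Finsupp.lcomapDomain (R := ZMod 2) (some : α → Option α) (Option.some_injective α)) ∘
      spoke = fun v => Finsupp.single v (1 : ZMod 2) := by
    classical
    ext v w
    simp [spoke, Finsupp.lcomapDomain, Finsupp.single_apply]
  rw [this]
  exact Finsupp.linearIndependent_single_one (ZMod 2) α

lemma bar_isLink_inr {G : Graph α β} {v : α} (hv : v ∈ V(G)) (c : Bool) :
    G.bar.IsLink (Sum.inr (v, c)) none (some v) :=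
  Or.inr ⟨v, c, rfl, hv, Or.inl ⟨rfl, rfl⟩⟩

lemma bar_isLink_inl {G : Graph α β} {u v : α} (hne : u ≠ v) (h : G.Adj u v) (c : Bool) :
    G.bar.IsLink (Sum.inl (s(u, v), c)) (some u) (some v) :=
  Or.inl ⟨(s(u, v), c), u, v, rfl, rfl, rfl, rfl, hne, h⟩

lemma mem_edgeSet_bar {G : Graph α β} {e : (Sym2 α × Bool) ⊕ (α × Bool)} (he : e ∈ E(G.bar)) :
    (∃ v c, v ∈ V(G) ∧ e = Sum.inr (v, c)) ∨
      ∃ u v c, u ≠ v ∧ G.Adj u v ∧ e = Sum.inl (s(u, v), c) := by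
  obtain ⟨a, b, ⟨⟨z, c⟩, u, v, rfl, -, -, hz, hne, h⟩ | ⟨v, c, rfl, hv, -⟩⟩ :=
    exists_isLink_of_mem_edgeSet he
  · refine Or.inr ⟨u, v, c, hne, h, ?_⟩
    rw [← hz]
  · exact Or.inl ⟨v, c, hv, rfl⟩

lemma finite_edgeSet_bar {G : Graph α β} (hV : V(G).Finite) : E(G.bar).Finite := by
  refine (((hV.prod hV).image fun p => s(p.1, p.2)).prod (Set.finite_univ (α := Bool))
    |>.image Sum.inl).union ((hV.prod (Set.finite_univ (α := Bool))).image Sum.inr)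
    |>.subset ?_
  intro e he
  rcases mem_edgeSet_bar he with ⟨v, c, hv, rfl⟩ | ⟨u, v, c, -, h, rfl⟩
  · exact Or.inr ⟨(v, c), ⟨hv, trivial⟩, rfl⟩
  · exact Or.inl ⟨(s(u, v), c), ⟨⟨(u, v), ⟨h.left_mem, h.right_mem⟩, rfl⟩, trivial⟩, rfl⟩

lemma incVec_bar_inr {G : Graph α β} {v : α} (hv : v ∈ V(G)) (c : Bool) :
    G.bar.incVec (Sum.inr (v, c)) = spoke v :=
  incVec_eq (bar_isLink_inr hv c)

lemma incVec_bar_inl {G : Graph α β} {u v : α} (hne : u ≠ v) (h : G.Adj u v) (c : Bool) :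
    G.bar.incVec (Sum.inl (s(u, v), c)) = spoke u + spoke v := by
  rw [incVec_eq (bar_isLink_inl hne h c), spoke, spoke, add_add_add_comm,
    ← Finsupp.single_add, CharTwo.add_self_eq_zero, Finsupp.single_zero, zero_add]

/-! ### Vertices joined to the apex, and rank bounds -/

/-- The vertices `v` such that the edges in `X` join `v` to the apex. -/
def apexReach (G : Graph α β) (X : Set ((Sym2 α × Bool) ⊕ (α × Bool))) : Set α :=
  {v | v ∈ V(G) ∧ spoke v ∈ Submodule.span (ZMod 2) (G.bar.incVec '' X)}

lemma apexReach_mono (G : Graph α β) {X Y : Set ((Sym2 α × Bool) ⊕ (α × Bool))} (h : X ⊆ Y) :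
    G.apexReach X ⊆ G.apexReach Y :=
  fun _ hv => ⟨hv.1, Submodule.span_mono (Set.image_mono h) hv.2⟩

lemma mem_apexReach_of_inr_mem {G : Graph α β} {X : Set ((Sym2 α × Bool) ⊕ (α × Bool))} {v : α}
    (hv : v ∈ V(G)) {c : Bool} (h : Sum.inr (v, c) ∈ X) : v ∈ G.apexReach X :=
  ⟨hv, Submodule.subset_span ⟨_, h, incVec_bar_inr hv c⟩⟩

lemma mem_apexReach_of_inl_mem {G : Graph α β} {X : Set ((Sym2 α × Bool) ⊕ (α × Bool))} {u v : α}
    (hu : u ∈ G.apexReach X) (hne : u ≠ v) (hadj : G.Adj u v) {c : Bool}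
    (h : Sum.inl (s(u, v), c) ∈ X) : v ∈ G.apexReach X := by
  refine ⟨hadj.right_mem, ?_⟩
  have h1 : G.bar.incVec (Sum.inl (s(u, v), c)) ∈
      Submodule.span (ZMod 2) (G.bar.incVec '' X) := Submodule.subset_span ⟨_, h, rfl⟩
  rw [incVec_bar_inl hne hadj] at h1
  exact (Submodule.add_mem_iff_right _ hu.2).1 h1

lemma mem_apexReach_edgeSet {G : Graph α β} {v : α} (hv : v ∈ V(G)) :
    v ∈ G.apexReach E(G.bar) :=
  mem_apexReach_of_inr_mem (c := true) hv (bar_isLink_inr hv true).edge_mem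

lemma card_le_eRk_bar {G : Graph α β} {X : Set ((Sym2 α × Bool) ⊕ (α × Bool))}
    (hX : X ⊆ E(G.bar)) (hfin : X.Finite) {A : Finset α} (hA : (A : Set α) ⊆ G.apexReach X) :
    A.card ≤ (G.bar.cycleMatroid.eRk X).toNat := by
  rw [eRk_cycleMatroid _ hX hfin]
  have hli : LinearIndependent (ZMod 2) (fun v : A => spoke (v : α)) :=
    linearIndependent_spoke.comp _ Subtype.val_injective
  have h1 := finrank_span_eq_card hli
  rw [Fintype.card_coe] at h1
  rw [← h1]
  have := FiniteDimensional.span_of_finite (ZMod 2) (hfin.image G.bar.incVec)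
  refine Submodule.finrank_mono (Submodule.span_le.2 ?_)
  rintro _ ⟨v, rfl⟩
  exact (hA v.2).2

/-- Every vector of `X` is a spoke at a vertex of `W` or a sum of two such spokes; the apex adds
nothing to the dimension. -/
lemma eRk_bar_le_card {G : Graph α β} {X : Set ((Sym2 α × Bool) ⊕ (α × Bool))}
    (hX : X ⊆ E(G.bar)) (hfin : X.Finite) {W : Finset α}
    (hinr : ∀ v c, Sum.inr (v, c) ∈ X → v ∈ W)
    (hinl : ∀ u v c, Sum.inl (s(u, v), c) ∈ X → u ∈ W ∧ v ∈ W) :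
    (G.bar.cycleMatroid.eRk X).toNat ≤ W.card := by
  classical
  rw [eRk_cycleMatroid _ hX hfin]
  have hle : Submodule.span (ZMod 2) (G.bar.incVec '' X) ≤
      Submodule.span (ZMod 2) ((W.image spoke : Finset (Option α →₀ ZMod 2)) : Set _) := by
    have hs : ∀ v ∈ W, spoke v ∈
        Submodule.span (ZMod 2) ((W.image spoke : Finset (Option α →₀ ZMod 2)) : Set _) :=
      fun v hv => Submodule.subset_span (Finset.mem_coe.2 (Finset.mem_image_of_mem _ hv))
    rw [Submodule.span_le]
    rintro _ ⟨e, he, rfl⟩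
    rcases mem_edgeSet_bar (hX he) with ⟨v, c, hv, rfl⟩ | ⟨u, v, c, hne, h, rfl⟩
    · rw [incVec_bar_inr hv]
      exact hs v (hinr v c he)
    · rw [incVec_bar_inl hne h]
      exact add_mem (hs u (hinl u v c he).1) (hs v (hinl u v c he).2)
  exact (Submodule.finrank_mono hle).trans
    ((finrank_span_finset_le_card _).trans Finset.card_image_le)

lemma eRk_bar_edgeSet {G : Graph α β} (hV : V(G).Finite) :
    (G.bar.cycleMatroid.eRk E(G.bar)).toNat = hV.toFinset.card := by
  refine le_antisymm (eRk_bar_le_card subset_rfl (finite_edgeSet_bar hV) ?_ ?_)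
    (card_le_eRk_bar subset_rfl (finite_edgeSet_bar hV) fun v hv =>
      mem_apexReach_edgeSet (by simpa using hv))
  · intro v c h
    rcases mem_edgeSet_bar h with ⟨v', c', hv, heq⟩ | ⟨u', v', c', -, h, heq⟩
    · cases heq
      simpa using hv
    · cases heq
  · intro u v c h
    rcases mem_edgeSet_bar h with ⟨v', c', hv, heq⟩ | ⟨u', v', c', -, h, heq⟩
    · cases heq
    · have := congrArg Prod.fst (Sum.inl_injective heq)
      have h1 := h.left_mem
      have h2 := h.right_mem
      rcases Sym2.eq_iff.1 this with ⟨rfl, rfl⟩ | ⟨rfl, rfl⟩ <;> simp [h1, h2]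

/-! ### Parallel pairs and the covering property -/

/-- A vertex that `Y` does not join to the apex is joined to it by the complement of any set with at
most one more edge than `Y`. -/
lemma mem_apexReach_compl {G : Graph α β} {X Y : Set ((Sym2 α × Bool) ⊕ (α × Bool))}
    (hXY : (X \ Y).Subsingleton) {v : α} (hv : v ∈ V(G)) (hvY : v ∉ G.apexReach Y) :
    v ∈ G.apexReach (E(G.bar) \ X) := by
  have hY : ∀ c, (Sum.inr (v, c) : (Sym2 α × Bool) ⊕ (α × Bool)) ∉ Y :=
    fun c h => hvY (mem_apexReach_of_inr_mem hv h)
  by_contra hcon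
  have hX : ∀ c, (Sum.inr (v, c) : (Sym2 α × Bool) ⊕ (α × Bool)) ∈ X := fun c => by
    by_contra h
    exact hcon (mem_apexReach_of_inr_mem (c := c) hv ⟨(bar_isLink_inr hv c).edge_mem, h⟩)
  -- Otherwise both parallel spokes at `v` lie in `X \ Y`, which has at most one element.
  simpa using hXY ⟨hX true, hY true⟩ ⟨hX false, hY false⟩

/-- If `Y` reaches `u` but not `v`, then `Y` contains neither copy of `uv`; one copy avoids `X` and
carries `u` to the apex through `v`. If `Y` reaches neither, each end keeps a spoke of its own. -/
lemma mem_apexReach_compl_of_adj {G : Graph α β} {X Y : Set ((Sym2 α × Bool) ⊕ (α × Bool))}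
    (hXY : (X \ Y).Subsingleton) {u v : α} (hadj : G.Adj u v) (hvY : v ∉ G.apexReach Y) :
    u ∈ G.apexReach (E(G.bar) \ X) ∧ v ∈ G.apexReach (E(G.bar) \ X) := by
  have hv := mem_apexReach_compl hXY hadj.right_mem hvY
  refine ⟨?_, hv⟩
  by_cases hu : u ∈ G.apexReach Y
  · have hne : u ≠ v := by
      rintro rfl
      exact hvY hu
    have hY : ∀ c, (Sum.inl (s(u, v), c) : (Sym2 α × Bool) ⊕ (α × Bool)) ∉ Y :=
      fun c h => hvY (mem_apexReach_of_inl_mem hu hne hadj h)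
    by_contra hcon
    have hX : ∀ c, (Sum.inl (s(u, v), c) : (Sym2 α × Bool) ⊕ (α × Bool)) ∈ X := fun c => by
      by_contra h
      refine hcon (mem_apexReach_of_inl_mem (c := c) hv hne.symm hadj.symm ?_)
      rw [Sym2.eq_swap]
      exact ⟨(bar_isLink_inl hne hadj c).edge_mem, h⟩
    simpa using hXY ⟨hX true, hY true⟩ ⟨hX false, hY false⟩
  · exact mem_apexReach_compl hXY hadj.left_mem hu

lemma subsingleton_take_succ_diff {γ : Type*} (l : List γ) (i : ℕ) :
    ({e | e ∈ l.take (i + 1)} \ {e | e ∈ l.take i}).Subsingleton := by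
  have key : ∀ e, e ∈ l.take (i + 1) → e ∉ l.take i → l[i]? = some e := by
    intro e he hne
    rw [List.take_add_one, List.mem_append] at he
    simpa using he.resolve_left hne
  rintro e ⟨he, he'⟩ f ⟨hf, hf'⟩
  exact Option.some_injective _ ((key e he he').symm.trans (key f hf hf'))

/-- Some initial segment of an ordering, as well as its complement, joins two given equal or adjacent
vertices to the apex. -/
lemma exists_mem_apexReach_take {G : Graph α β} {l : List ((Sym2 α × Bool) ⊕ (α × Bool))}
    (hl : G.bar.cycleMatroid.IsOrdering l) {u v : α} (hu : u ∈ V(G)) (hv : v ∈ V(G))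
    (huv : u = v ∨ G.Adj u v) :
    ∃ i ≤ l.length, (u ∈ G.apexReach {e | e ∈ l.take i} ∧ v ∈ G.apexReach {e | e ∈ l.take i}) ∧
      u ∈ G.apexReach (E(G.bar) \ {e | e ∈ l.take i}) ∧
      v ∈ G.apexReach (E(G.bar) \ {e | e ∈ l.take i}) := by
  classical
  have hlen : u ∈ G.apexReach {e | e ∈ l.take l.length} ∧
      v ∈ G.apexReach {e | e ∈ l.take l.length} := by
    have : {e | e ∈ l.take l.length} = E(G.bar) := by
      ext e
      simpa using hl.2 e
    rw [this]
    exact ⟨mem_apexReach_edgeSet hu, mem_apexReach_edgeSet hv⟩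
  have hex : ∃ i, u ∈ G.apexReach {e | e ∈ l.take i} ∧ v ∈ G.apexReach {e | e ∈ l.take i} :=
    ⟨_, hlen⟩
  -- Take the first prefix reaching both vertices: the prefix one edge shorter misses at least one
  -- of them.
  refine ⟨Nat.find hex, Nat.find_min' hex hlen, Nat.find_spec hex, ?_⟩
  rcases hi : Nat.find hex with _ | i
  · simpa using ⟨mem_apexReach_edgeSet hu, mem_apexReach_edgeSet hv⟩
  · have hmin := Nat.find_min hex (m := i) (by omega)
    have hsub := subsingleton_take_succ_diff l i
    rcases huv with rfl | hadj
    · rw [and_self] at hmin ⊢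
      exact mem_apexReach_compl hsub hu hmin
    · by_cases hvY : v ∈ G.apexReach {e | e ∈ l.take i}
      · exact (mem_apexReach_compl_of_adj hsub hadj.symm fun h => hmin ⟨h, hvY⟩).symm
      · exact mem_apexReach_compl_of_adj hsub hadj hvY

lemma apexReach_union_compl {G : Graph α β} (X : Set ((Sym2 α × Bool) ⊕ (α × Bool))) {v : α}
    (hv : v ∈ V(G)) : v ∈ G.apexReach X ∨ v ∈ G.apexReach (E(G.bar) \ X) := by
  by_cases h : v ∈ G.apexReach X
  · exact Or.inl h
  · exact Or.inr (mem_apexReach_compl (by simp) hv h)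

/-! ### From an ordering to a path-decomposition -/

lemma exists_isPathDecomposition_of_isOrdering {G : Graph α β} (hV : V(G).Finite)
    {l : List ((Sym2 α × Bool) ⊕ (α × Bool))} (hl : G.bar.cycleMatroid.IsOrdering l) :
    ∃ (t : ℕ) (𝒱 : Fin (t + 1) → Finset α), G.IsPathDecomposition 𝒱 ∧
      pathDecompositionWidth 𝒱 + 1 ≤ G.bar.cycleMatroid.orderingWidth l := by
  classical
  let A : ℕ → Finset α := fun i => {v ∈ hV.toFinset | v ∈ G.apexReach {e | e ∈ l.take i}}
  let B : ℕ → Finset α :=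
    fun i => {v ∈ hV.toFinset | v ∈ G.apexReach (E(G.bar) \ {e | e ∈ l.take i})}
  have hA : ∀ i v, v ∈ A i ↔ v ∈ G.apexReach {e | e ∈ l.take i} := fun i v => by
    simpa [A] using fun h : v ∈ G.apexReach _ => h.1
  have hB : ∀ i v, v ∈ B i ↔ v ∈ G.apexReach (E(G.bar) \ {e | e ∈ l.take i}) := fun i v => by
    simpa [B] using fun h : v ∈ G.apexReach _ => h.1
  have hmono : ∀ {i j : ℕ}, i ≤ j → {e | e ∈ l.take i} ⊆ {e | e ∈ l.take j} :=
    fun hij e he => (List.take_sublist_take_left hij).subset he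
  have hex : ∀ u v, u ∈ V(G) → v ∈ V(G) → (u = v ∨ G.Adj u v) →
      ∃ i : Fin (l.length + 1), u ∈ A i ∩ B i ∧ v ∈ A i ∩ B i := by
    intro u v hu hv huv
    obtain ⟨i, hi, h1, h2⟩ := exists_mem_apexReach_take hl hu hv huv
    refine ⟨⟨i, by omega⟩, ?_⟩
    simp only [Finset.mem_inter, hA, hB]
    exact ⟨⟨h1.1, h2.1⟩, h1.2, h2.2⟩
  refine ⟨l.length, fun i => A i ∩ B i, ⟨?_, ?_, ?_⟩, ?_⟩
  · ext v
    simp only [Set.mem_iUnion, Finset.mem_coe]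
    constructor
    · rintro ⟨i, hi⟩
      exact ((hA _ _).1 (Finset.mem_inter.1 hi).1).1
    · intro hv
      obtain ⟨i, hi, -⟩ := hex v v hv hv (Or.inl rfl)
      exact ⟨i, hi⟩
  · exact fun u v h => hex u v h.left_mem h.right_mem (Or.inr h)
  · intro i j k hij hjk v hi hk
    simp only [Finset.mem_inter, hA, hB] at hi hk ⊢
    exact ⟨G.apexReach_mono (hmono (Fin.le_def.1 hij.le)) hi.1,
      G.apexReach_mono (Set.sdiff_subset_sdiff_right (hmono (Fin.le_def.1 hjk.le))) hk.2⟩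
  -- The `+ 1` cancels the `- 1` in the width, leaving |A i ∩ B i| ≤ λ for each prefix.
  · rw [pathDecompositionWidth, sub_add_cancel, Finset.sup'_le_iff]
    rintro i -
    refine le_trans ?_ (Finset.le_sup' (fun i => G.bar.cycleMatroid.connectivity
      {e | e ∈ l.take i}) (Finset.mem_range.2 i.2))
    have hE := finite_edgeSet_bar hV
    have hsub : {e | e ∈ l.take i} ⊆ E(G.bar) :=
      fun e he => (hl.2 e).1 (List.mem_of_mem_take he)
    have h1 := card_le_eRk_bar hsub (hE.subset hsub) (A := A i) (fun v hv => (hA _ _).1 hv)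
    have h2 := card_le_eRk_bar (X := E(G.bar) \ {e | e ∈ l.take i}) Set.sdiff_subset
      (hE.subset Set.sdiff_subset) (A := B i) (fun v hv => (hB _ _).1 hv)
    have h3 : A i ∪ B i = hV.toFinset := by
      ext v
      rw [Finset.mem_union, hA, hB, Set.Finite.mem_toFinset]
      exact ⟨fun h => h.elim And.left And.left, fun h => apexReach_union_compl _ h⟩
    have h4 := Finset.card_union_add_card_inter (A i) (B i)
    simp only [Matroid.connectivity, cycleMatroid_ground]
    rw [eRk_bar_edgeSet hV, ← h3]
    omega

/-! ### From a path-decomposition to an ordering -/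

lemma exists_isOrdering_of_isPathDecomposition {G : Graph α β} (hV : V(G).Finite) {t : ℕ}
    {𝒱 : Fin (t + 1) → Finset α} (h𝒱 : G.IsPathDecomposition 𝒱) :
    ∃ l, G.bar.cycleMatroid.IsOrdering l ∧
      G.bar.cycleMatroid.orderingWidth l ≤ pathDecompositionWidth 𝒱 + 1 := by
  classical
  have hE := finite_edgeSet_bar hV
  have hbag : ∀ e ∈ E(G.bar), ∃ i, (∀ v c, e = Sum.inr (v, c) → v ∈ 𝒱 i) ∧
      ∀ u v c, e = Sum.inl (s(u, v), c) → u ∈ 𝒱 i ∧ v ∈ 𝒱 i := by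
    intro e he
    rcases mem_edgeSet_bar he with ⟨v, c, hv, rfl⟩ | ⟨u, v, c, -, h, rfl⟩
    · rw [← h𝒱.iUnion_eq, Set.mem_iUnion] at hv
      obtain ⟨i, hi⟩ := hv
      refine ⟨i, ?_, by simp⟩
      intro v' c' heq
      cases heq
      exact hi
    · obtain ⟨i, hu, hv⟩ := h𝒱.exists_mem_of_adj u v h
      refine ⟨i, by simp, ?_⟩
      intro u' v' c' heq
      rcases Sym2.eq_iff.1 (congrArg Prod.fst (Sum.inl_injective heq)) with
        ⟨rfl, rfl⟩ | ⟨rfl, rfl⟩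
      exacts [⟨hu, hv⟩, ⟨hv, hu⟩]
  -- The index of a bag holding the non-apex ends of the edge; the value `0` off the edge set is a
  -- dummy.
  let f : (Sym2 α × Bool) ⊕ (α × Bool) → Fin (t + 1) :=
    fun e => if h : e ∈ E(G.bar) then (hbag e h).choose else 0
  have hf : ∀ e ∈ E(G.bar), (∀ v c, e = Sum.inr (v, c) → v ∈ 𝒱 (f e)) ∧
      ∀ u v c, e = Sum.inl (s(u, v), c) → u ∈ 𝒱 (f e) ∧ v ∈ 𝒱 (f e) := by
    intro e he
    simp only [f, dif_pos he]
    exact (hbag e he).choose_spec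
  let r : (Sym2 α × Bool) ⊕ (α × Bool) → (Sym2 α × Bool) ⊕ (α × Bool) → Prop :=
    fun a b => f a ≤ f b
  have : Std.Total r := ⟨fun a b => le_total (f a) (f b)⟩
  have : IsTrans _ r := ⟨fun a b c => le_trans (a := f a)⟩
  let l := hE.toFinset.toList.insertionSort r
  have hl : G.bar.cycleMatroid.IsOrdering l :=
    ⟨(List.perm_insertionSort r _).nodup_iff.2 (Finset.nodup_toList _), fun e => by simp [l]⟩
  have hsort : l.Pairwise r := List.pairwise_insertionSort r _
  refine ⟨l, hl, ?_⟩
  rw [Matroid.orderingWidth, Finset.sup'_le_iff]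
  intro i hi
  have hsub : {e | e ∈ l.take i} ⊆ E(G.bar) :=
    fun e he => (hl.2 e).1 (List.mem_of_mem_take he)
  -- The threshold `j` is the bag index of the first edge after the cut, or the last index if no
  -- edge remains.
  obtain ⟨j, hj1, hj2⟩ : ∃ j, (∀ e ∈ l.take i, f e ≤ j) ∧ ∀ e ∈ l.drop i, j ≤ f e := by
    have happ : (l.take i ++ l.drop i).Pairwise r := by rwa [List.take_append_drop]
    rw [List.pairwise_append] at happ
    obtain ⟨-, h2, h3⟩ := happ
    rcases hd : l.drop i with _ | ⟨d, l'⟩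
    · exact ⟨Fin.last t, fun e _ => Fin.le_last _, by simp⟩
    · rw [hd] at h2 h3
      refine ⟨f d, fun e he => h3 e he d (by simp), fun e he => ?_⟩
      rcases List.mem_cons.1 he with rfl | he
      exacts [le_rfl, (List.pairwise_cons.1 h2).1 e he]
  have hj2' : ∀ e ∈ E(G.bar) \ {e | e ∈ l.take i}, j ≤ f e := by
    rintro e ⟨he, hne⟩
    have : e ∈ l.take i ++ l.drop i := by
      rw [List.take_append_drop]
      exact (hl.2 e).2 he
    exact hj2 e ((List.mem_append.1 this).resolve_left hne)
  let A : Finset α := {v ∈ hV.toFinset | ∃ k ≤ j, v ∈ 𝒱 k}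
  let B : Finset α := {v ∈ hV.toFinset | ∃ k, j ≤ k ∧ v ∈ 𝒱 k}
  have hmem : ∀ {v k}, v ∈ 𝒱 k → v ∈ V(G) := fun {v k} hv => by
    rw [← h𝒱.iUnion_eq]
    exact Set.mem_iUnion.2 ⟨k, hv⟩
  have hA : ∀ {v k}, k ≤ j → v ∈ 𝒱 k → v ∈ A := fun {v k} hk hv => by
    simpa [A] using ⟨hmem hv, k, hk, hv⟩
  have hB : ∀ {v k}, j ≤ k → v ∈ 𝒱 k → v ∈ B := fun {v k} hk hv => by
    simpa [B] using ⟨hmem hv, k, hk, hv⟩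
  have h1 : (G.bar.cycleMatroid.eRk {e | e ∈ l.take i}).toNat ≤ A.card :=
    eRk_bar_le_card hsub (hE.subset hsub)
      (fun v c h => hA (hj1 _ h) ((hf _ (hsub h)).1 v c rfl))
      (fun u v c h => ⟨hA (hj1 _ h) ((hf _ (hsub h)).2 u v c rfl).1,
        hA (hj1 _ h) ((hf _ (hsub h)).2 u v c rfl).2⟩)
  have h2 : (G.bar.cycleMatroid.eRk (E(G.bar) \ {e | e ∈ l.take i})).toNat ≤ B.card :=
    eRk_bar_le_card Set.sdiff_subset (hE.subset Set.sdiff_subset)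
      (fun v c h => hB (hj2' _ h) ((hf _ h.1).1 v c rfl))
      (fun u v c h => ⟨hB (hj2' _ h) ((hf _ h.1).2 u v c rfl).1,
        hB (hj2' _ h) ((hf _ h.1).2 u v c rfl).2⟩)
  have h3 : A ∪ B = hV.toFinset := by
    refine Finset.Subset.antisymm
      (Finset.union_subset (Finset.filter_subset _ _) (Finset.filter_subset _ _)) fun v hv => ?_
    rw [Set.Finite.mem_toFinset, ← h𝒱.iUnion_eq, Set.mem_iUnion] at hv
    obtain ⟨k, hk⟩ := hv
    exact Finset.mem_union.2 ((le_total k j).imp (fun h => hA h hk) fun h => hB h hk)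
  -- A vertex in a bag at or before `j` and in one at or after `j` lies in the bag `j` by the
  -- interval property.
  have h4 : A ∩ B ⊆ 𝒱 j := by
    intro v hv
    simp only [A, B, Finset.mem_inter, Finset.mem_filter] at hv
    obtain ⟨⟨-, k, hk, hvk⟩, -, m, hm, hvm⟩ := hv
    rcases hk.eq_or_lt with rfl | hk
    · exact hvk
    rcases hm.eq_or_lt with rfl | hm
    · exact hvm
    exact h𝒱.mem_of_lt_of_lt k j m hk hm v hvk hvm
  have h5 := Finset.card_le_card h4
  have h6 := Finset.card_union_add_card_inter A B
  have h7 : ((𝒱 j).card : ℤ) ≤ pathDecompositionWidth 𝒱 + 1 := by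
    rw [pathDecompositionWidth, sub_add_cancel]
    exact Finset.le_sup' (fun i => ((𝒱 i).card : ℤ)) (Finset.mem_univ j)
  refine le_trans ?_ h7
  simp only [Matroid.connectivity, cycleMatroid_ground]
  rw [eRk_bar_edgeSet hV, ← h3]
  omega

/-! ### Both minima exist -/

/-- Equality holds when all bags are empty, the case of an empty vertex set. -/
lemma neg_one_le_pathDecompositionWidth {t : ℕ} (𝒱 : Fin (t + 1) → Finset α) :
    -1 ≤ pathDecompositionWidth 𝒱 := by
  have := Finset.le_sup' (fun i => ((𝒱 i).card : ℤ)) (Finset.mem_univ 0)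
  simp only [pathDecompositionWidth]
  omega

lemma exists_isPathDecomposition {G : Graph α β} (hV : V(G).Finite) :
    ∃ (t : ℕ) (𝒱 : Fin (t + 1) → Finset α), G.IsPathDecomposition 𝒱 :=
  ⟨0, fun _ => hV.toFinset, by
      rw [hV.coe_toFinset]
      exact Set.iUnion_const _,
    fun _ _ h => ⟨0, by simpa using h.left_mem, by simpa using h.right_mem⟩,
    fun _ _ _ _ _ _ h _ => h⟩

end Graph

lemma Matroid.orderingWidth_nonneg {γ : Type*} (M : Matroid γ) (l : List γ) :
    0 ≤ M.orderingWidth l := by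
  refine le_trans ?_ (Finset.le_sup' (fun i => M.connectivity {e | e ∈ l.take i})
    (Finset.mem_range.2 (Nat.succ_pos _)))
  simp [Matroid.connectivity]

end

theorem proposition3p1 {α β : Type*} (G : Graph α β) (hV : G.vertexSet.Finite) :
    G.bar.cycleMatroid.pathwidth = G.pathwidth + 1 := by
  have hbddG : BddBelow {w | ∃ (t : ℕ) (𝒱 : Fin (t + 1) → Finset α),
      G.IsPathDecomposition 𝒱 ∧ w = Graph.pathDecompositionWidth 𝒱} := by
    refine ⟨-1, ?_⟩
    rintro _ ⟨t, 𝒱, -, rfl⟩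
    exact Graph.neg_one_le_pathDecompositionWidth 𝒱
  have hbddM : BddBelow {w | ∃ l, G.bar.cycleMatroid.IsOrdering l ∧
      w = G.bar.cycleMatroid.orderingWidth l} := by
    refine ⟨0, ?_⟩
    rintro _ ⟨l, -, rfl⟩
    exact Matroid.orderingWidth_nonneg _ l
  have hneG : {w | ∃ (t : ℕ) (𝒱 : Fin (t + 1) → Finset α),
      G.IsPathDecomposition 𝒱 ∧ w = Graph.pathDecompositionWidth 𝒱}.Nonempty := by
    obtain ⟨t, 𝒱, h𝒱⟩ := Graph.exists_isPathDecomposition hV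
    exact ⟨_, t, 𝒱, h𝒱, rfl⟩
  have hneM : {w | ∃ l, G.bar.cycleMatroid.IsOrdering l ∧
      w = G.bar.cycleMatroid.orderingWidth l}.Nonempty := by
    obtain ⟨t, 𝒱, h𝒱⟩ := Graph.exists_isPathDecomposition hV
    obtain ⟨l, hl, -⟩ := Graph.exists_isOrdering_of_isPathDecomposition hV h𝒱
    exact ⟨_, l, hl, rfl⟩
  -- Nonempty sets of integers bounded below attain their infima, so each inequality starts from an
  -- optimal object on one side and converts it.
  apply le_antisymm
  · obtain ⟨t, 𝒱, h𝒱, hw⟩ := Int.csInf_mem hneG hbddG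
    obtain ⟨l, hl, hle⟩ := Graph.exists_isOrdering_of_isPathDecomposition hV h𝒱
    rw [Graph.pathwidth, hw]
    exact (csInf_le hbddM ⟨l, hl, rfl⟩).trans hle
  · obtain ⟨l, hl, hw⟩ := Int.csInf_mem hneM hbddM
    obtain ⟨t, 𝒱, h𝒱, hle⟩ := Graph.exists_isPathDecomposition_of_isOrdering hV hl
    rw [Matroid.pathwidth, hw]
    refine le_trans ?_ hle
    have := csInf_le hbddG ⟨t, 𝒱, h𝒱, rfl⟩
    rw [Graph.pathwidth]
    omega
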